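/- Let $F_{\mathbb L}(u,v)=u+_{\mathbb L}v=u+v+\sum_{i,j\ge 1}a_{i,j}u^iv^j$ be the universal commutative one-dimensional formal group law over the Lazard ring $\mathbb L$, and let $\bar u=[-1]_{\mathbb L}(u)$ be its formal inverse. Let $n\ge 1$ and $\mathbf x_n=(x_1,\dots,x_n)$. For a partition $\lambda=(\lambda_1\ge\dots\ge\lambda_n\ge 0)$ with stabilizer $S_n^\lambda\subset S_n$, the new universal Schur function is $$\mathbb S^{\mathbb L}_\lambda(\mathbf x_n)=\sum_{\bar w\in S_n/S_n^\lambda} w\cdot\left[\frac{\prod_{i=1}^n x_i^{\lambda_i+\#\{j\,:\,\lambda_j<\lambda_i\}}}{\prod_{\lambda_i>\lambda_j}(x_i+_{\mathbb L}\bar x_j)}\right].$$ Define $\mathbb S^{\mathbb L}_k(\mathbf x_n)$ for all $k\in\mathbb Z$ as follows: for $k\ge 1$ it is $\mathbb S^{\mathbb L}_{(k)}(\mathbf x_n)$ with $(k)=(k,0,\dots,0)$; for $1-n\le k\le 0$ it is $$\sum_{i=1}^n \frac{x_i^{k+n-1}}{\prod_{j\ne i}(x_i+_{\mathbb L}\bar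 x_j)};$$ and for $k<1-n$ it is the residue $$\operatorname{Res}_{t=0}\frac{t^{k+n-1}\,dt}{\bigl(1+\sum_{i\ge1}a_{i,1}t^i\bigr)\prod_{i=1}^n(t+_{\mathbb L}\bar x_i)},$$ that is, the coefficient of $t^{-1}$ of this Laurent series. The fractions in the two sums are taken in the total ring of fractions of $\mathbb L[[x_1,\dots,x_n]]$. Laurent series in $t$ are taken in $\mathbb L((t))[[x_1,\dots,x_n]]$, that is, expanded so that $(t-x)^{-1}=\sum_{m\ge0}x^mt^{-m-1}$. Then all the denominators above are invertible in the respective rings, every $\mathbb S^{\mathbb L}_k(\mathbf x_n)$ lies in $\mathbb L[[x_1,\dots,x_n]]$, and with $u=t^{-1}$ $$\sum_{k\in\mathbb Z}\mathbb S^{\mathbb L}_k(\mathbf x_n)\,u^k=\frac{u^{-n}}{\bigl(1+\sum_{i\ge1}a_{i,1}u^{-i}\bigr)\prod_{i=1}^n(u^{-1}+_{\mathbb L}\bar x_i)} ,$$ that is, for every $k\in\mathbb Z$ the coefficient of $u^k=t^{-k}$ of the right-hand side is $\mathbb S^{\mathbb L}_k(\mathbf x_n)$. -/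

import Mathlib

noncomputable section

namespace UniversalSchur

open MvPowerSeries

/-! ### Formal sums and formal inverses -/

section FormalInverse

variable {R : Type*} [CommRing R]

/-- The formal sum `f +_F g = F(f, g)` of two power series without constant term. -/
def fsum (F : FormalGroup R) {σ : Type*} (f g : MvPowerSeries σ R) : MvPowerSeries σ R :=
  F.toPowerSeries.subst ![f, g]

theorem hasSubst_pair {a : PowerSeries R} (ha : a.constantCoeff = 0) :
    HasSubst ![(PowerSeries.X : PowerSeries R), a] :=
  hasSubst_of_constantCoeff_zero fun s => by
    fin_cases s
    · exact PowerSeries.constantCoeff_X (R := R)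
    · exact ha

theorem coeff_fsum_term (a : PowerSeries R) (m : ℕ) (r : R) (d : Fin 2 →₀ ℕ) :
    r • MvPowerSeries.coeff (Finsupp.single () m)
        (d.prod fun s e => (![(PowerSeries.X : PowerSeries R), a] s) ^ e) =
      r * PowerSeries.coeff m (PowerSeries.X ^ (d 0) * a ^ (d 1)) := by
  rw [smul_eq_mul, Finsupp.prod_fintype _ _ (by simp)]
  simp [Fin.prod_univ_two, PowerSeries.coeff]

theorem coeff_fsum_X (F : FormalGroup R) {a : PowerSeries R} (ha : a.constantCoeff = 0) (m : ℕ) :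
    PowerSeries.coeff m (fsum F PowerSeries.X a) =
      ∑ᶠ d : Fin 2 →₀ ℕ, MvPowerSeries.coeff d F.toPowerSeries *
        PowerSeries.coeff m (PowerSeries.X ^ (d 0) * a ^ (d 1)) := by
  rw [fsum, PowerSeries.coeff, coeff_subst (hasSubst_pair ha)]
  exact finsum_congr fun d => coeff_fsum_term a m _ d

theorem finite_fsum_X (F : FormalGroup R) {a : PowerSeries R} (ha : a.constantCoeff = 0) (m : ℕ) :
    (fun d : Fin 2 →₀ ℕ => MvPowerSeries.coeff d F.toPowerSeries *
        PowerSeries.coeff m (PowerSeries.X ^ (d 0) * a ^ (d 1))).HasFiniteSupport := by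
  have := coeff_subst_finite (hasSubst_pair ha) F.toPowerSeries (Finsupp.single () m)
  simpa only [coeff_fsum_term] using this

theorem coeff_fsum_X_congr (F : FormalGroup R) {a b e : PowerSeries R} {m : ℕ}
    (ha : a.constantCoeff = 0) (hb : b.constantCoeff = 0) (h : a = b + PowerSeries.X ^ m * e) :
    PowerSeries.coeff m (fsum F PowerSeries.X a) =
      PowerSeries.coeff m (fsum F PowerSeries.X b) + e.constantCoeff := by
  rw [← sub_eq_iff_eq_add', coeff_fsum_X F ha, coeff_fsum_X F hb,
    ← finsum_sub_distrib (finite_fsum_X F ha m) (finite_fsum_X F hb m),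
    finsum_eq_single _ (Finsupp.single 1 1)]
  · have : PowerSeries.coeff m (PowerSeries.X ^ m * e) = e.constantCoeff := by
      simp [PowerSeries.coeff_X_pow_mul']
    simp [F.lin_coeff_Y, h, this]
  · intro d hd
    rw [← mul_sub, ← map_sub, ← mul_sub]
    obtain ⟨q, hq⟩ : ∃ q, PowerSeries.X ^ (d 0) * (a ^ (d 1) - b ^ (d 1)) =
        PowerSeries.X ^ (m + 1) * q := by
      have key : a ^ (d 1) - b ^ (d 1) =
          PowerSeries.X ^ m * (e * ∑ i ∈ Finset.range (d 1), a ^ i * b ^ (d 1 - 1 - i)) := by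
        rw [← (Commute.all a b).mul_geom_sum₂, h]; ring
      rw [key]
      by_cases h0 : d 0 = 0
      · by_cases h1 : d 1 = 1
        · exact absurd (by ext i; fin_cases i <;> simp [h0, h1]) hd
        · have : PowerSeries.X ∣ ∑ i ∈ Finset.range (d 1), a ^ i * b ^ (d 1 - 1 - i) := by
            rw [PowerSeries.X_dvd_iff, map_sum]
            refine Finset.sum_eq_zero fun i hi => ?_
            have := Finset.mem_range.1 hi
            rw [map_mul, map_pow, map_pow, ha, hb]
            by_cases hi0 : i = 0
            · subst hi0
              rw [zero_pow (n := d 1 - 1 - 0) (by omega), mul_zero]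
            · rw [zero_pow hi0, zero_mul]
          obtain ⟨q, hq⟩ := this
          exact ⟨e * q, by rw [hq, h0]; ring⟩
      · obtain ⟨k, hk⟩ := Nat.exists_eq_succ_of_ne_zero h0
        exact ⟨PowerSeries.X ^ k * (e * ∑ i ∈ Finset.range (d 1), a ^ i * b ^ (d 1 - 1 - i)),
          by rw [hk, Nat.succ_eq_add_one, pow_succ, pow_succ]; ring⟩
    rw [hq]
    simp [PowerSeries.coeff_X_pow_mul']

/-- The coefficients of the formal inverse, by recursion. -/
def inverseCoeff (F : FormalGroup R) : ℕ → R
  | m => - PowerSeries.coeff m (fsum F PowerSeries.X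
      (PowerSeries.mk fun i => if _h : i < m then inverseCoeff F i else 0))

/-- The formal inverse `χ(u) = [-1]_F(u)`: the unique power series with `χ(0) = 0` and
`F(u, χ(u)) = 0`. -/
def formalInverse (F : FormalGroup R) : PowerSeries R :=
  PowerSeries.mk (inverseCoeff F)

theorem constantCoeff_fsum_X (F : FormalGroup R) {a : PowerSeries R}
    (ha : a.constantCoeff = 0) : PowerSeries.constantCoeff (fsum F PowerSeries.X a) = 0 :=
  constantCoeff_subst_eq_zero (hasSubst_pair ha)
    (fun s => by
      fin_cases s
      · exact PowerSeries.constantCoeff_X (R := R)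
      · exact ha) F.zero_constantCoeff

theorem constantCoeff_formalInverse (F : FormalGroup R) :
    (formalInverse F).constantCoeff = 0 := by
  rw [← PowerSeries.coeff_zero_eq_constantCoeff_apply, formalInverse, PowerSeries.coeff_mk,
    inverseCoeff]
  simp only [Nat.not_lt_zero, dite_false, PowerSeries.coeff_zero_eq_constantCoeff_apply]
  rw [constantCoeff_fsum_X F (by simp [← PowerSeries.coeff_zero_eq_constantCoeff_apply]), neg_zero]

/-- `u +_F χ(u) = 0`. -/
theorem fsum_formalInverse (F : FormalGroup R) :
    fsum F PowerSeries.X (formalInverse F) = 0 := by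
  ext m
  rcases eq_or_ne m 0 with rfl | hm
  · simpa using constantCoeff_fsum_X F (constantCoeff_formalInverse F)
  set b : PowerSeries R := PowerSeries.mk fun i => if _h : i < m then inverseCoeff F i else 0
    with hb
  have hb0 : b.constantCoeff = 0 := by
    have := constantCoeff_formalInverse F
    rw [← PowerSeries.coeff_zero_eq_constantCoeff_apply, formalInverse,
      PowerSeries.coeff_mk] at this
    rw [← PowerSeries.coeff_zero_eq_constantCoeff_apply, hb, PowerSeries.coeff_mk]
    simp [this]
  obtain ⟨e, he⟩ : PowerSeries.X ^ m ∣ formalInverse F - b := by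
    rw [PowerSeries.X_pow_dvd_iff]
    intro i hi
    simp [formalInverse, hb, hi]
  have he0 : e.constantCoeff = inverseCoeff F m := by
    have := congrArg (PowerSeries.coeff m) he
    simpa [formalInverse, hb, PowerSeries.coeff_X_pow_mul'] using this.symm
  rw [coeff_fsum_X_congr F (constantCoeff_formalInverse F) hb0
    (by rw [← he]; ring : formalInverse F = b + PowerSeries.X ^ m * e), he0, inverseCoeff]
  simp [hb]

/-- The formal inverse `[-1]_F(f)` of a power series without constant term. -/
def finv (F : FormalGroup R) {σ : Type*} (f : MvPowerSeries σ R) : MvPowerSeries σ R :=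
  (formalInverse F).subst f

end FormalInverse

/-! ### The Lazard ring and the universal formal group law -/

section Lazard

/-- The series `∑_{i,j ≥ 1} a_{i,j} u^i v^j` over `ℤ[a_{i,j} : i, j ≥ 1]`. -/
def genericTail : MvPowerSeries (Fin 2) (MvPolynomial (ℕ+ × ℕ+) ℤ) := fun d =>
  if h : 0 < d 0 ∧ 0 < d 1 then MvPolynomial.X ((d 0).toPNat h.1, (d 1).toPNat h.2) else 0

theorem coeff_genericTail (d : Fin 2 →₀ ℕ) : coeff d genericTail =
    if h : 0 < d 0 ∧ 0 < d 1 then MvPolynomial.X ((d 0).toPNat h.1, (d 1).toPNat h.2) else 0 := rfl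

/-- The series `u + v + ∑_{i,j ≥ 1} a_{i,j} u^i v^j` over `ℤ[a_{i,j} : i, j ≥ 1]`. -/
def genericSeries : MvPowerSeries (Fin 2) (MvPolynomial (ℕ+ × ℕ+) ℤ) :=
  X 0 + X 1 + genericTail

/-- The ideal generated by the coefficients of `F(u, v) - F(v, u)` and of
`F(F(u, v), w) - F(u, F(v, w))`, where `F` is the generic series. -/
def lazardIdeal : Ideal (MvPolynomial (ℕ+ × ℕ+) ℤ) :=
  Ideal.span
    (Set.range (fun d : Fin 2 →₀ ℕ =>
        coeff d (genericSeries - genericSeries.subst ![X 1, (X 0 : MvPowerSeries (Fin 2) _)])) ∪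
      Set.range (fun d : Fin 3 →₀ ℕ =>
        coeff d (genericSeries.subst
            ![genericSeries.subst ![X 0, (X 1 : MvPowerSeries (Fin 3) _)], X 2] -
          genericSeries.subst
            ![X 0, genericSeries.subst ![X 1, (X 2 : MvPowerSeries (Fin 3) _)]])))

/-- The Lazard ring `𝕃`. -/
abbrev LazardRing : Type := MvPolynomial (ℕ+ × ℕ+) ℤ ⧸ lazardIdeal

theorem constantCoeff_genericSeries : constantCoeff genericSeries = 0 := by
  simp only [genericSeries, map_add, constantCoeff_X, zero_add]
  rw [← coeff_zero_eq_constantCoeff_apply, coeff_genericTail]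
  simp

theorem map_pair {A B σ : Type*} [CommRing A] [CommRing B] (f : A →+* B)
    (g₁ g₂ : MvPowerSeries σ A) :
    (fun i => (![g₁, g₂] i).map f) = ![g₁.map f, g₂.map f] := by
  ext1 i; fin_cases i <;> simp

theorem map_mk_eq {σ : Type*} {f g : MvPowerSeries σ (MvPolynomial (ℕ+ × ℕ+) ℤ)}
    (h : ∀ d, coeff d (f - g) ∈ lazardIdeal) :
    f.map (Ideal.Quotient.mk lazardIdeal) = g.map (Ideal.Quotient.mk lazardIdeal) := by
  ext d
  rw [coeff_map, coeff_map, Ideal.Quotient.eq, ← map_sub]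
  exact h d

/-- The universal formal group law `F_𝕃(u, v) = u + v + ∑_{i,j ≥ 1} a_{i,j} u^i v^j` over `𝕃`. -/
def lazardLaw : FormalGroup LazardRing where
  toPowerSeries := genericSeries.map (Ideal.Quotient.mk lazardIdeal)
  zero_constantCoeff := by
    rw [constantCoeff_map, constantCoeff_genericSeries, map_zero]
  lin_coeff_X := by
    have : coeff (Finsupp.single 0 1) genericSeries = 1 := by
      simp [genericSeries, coeff_index_single_X, coeff_genericTail]
    rw [coeff_map, this, map_one]
  lin_coeff_Y := by
    have : coeff (Finsupp.single 1 1) genericSeries = 1 := by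
      simp [genericSeries, coeff_index_single_X, coeff_genericTail]
    rw [coeff_map, this, map_one]
  assoc := by
    have h := map_mk_eq (f := genericSeries.subst
            ![genericSeries.subst ![X 0, (X 1 : MvPowerSeries (Fin 3) _)], X 2])
          (g := genericSeries.subst
            ![X 0, genericSeries.subst ![X 1, (X 2 : MvPowerSeries (Fin 3) _)]])
          (fun d => Ideal.subset_span (Or.inr ⟨d, rfl⟩))
    rwa [map_subst (HasSubst.cons_subst_zero_left (0 : Fin 3) 1 2 constantCoeff_genericSeries),
      map_subst (HasSubst.cons_subst_zero_right (0 : Fin 3) 1 2 constantCoeff_genericSeries),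
      map_pair, map_pair, map_subst HasSubst.X_X, map_subst HasSubst.X_X, map_pair, map_pair,
      map_X, map_X, map_X] at h

instance lazardLaw_isComm : lazardLaw.IsComm where
  comm := by
    have h := map_mk_eq (f := genericSeries)
          (g := genericSeries.subst ![X 1, (X 0 : MvPowerSeries (Fin 2) _)])
          (fun d => Ideal.subset_span (Or.inl ⟨d, rfl⟩))
    rwa [map_subst HasSubst.X_X, map_pair, map_X, map_X] at h

theorem coeff_single_zero {S : Type*} [CommRing S] (G : FormalGroup S) (i : ℕ) :
    coeff (Finsupp.single 0 i) G.toPowerSeries = if i = 1 then 1 else 0 := by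
  have h := congrArg (PowerSeries.coeff i) G.Xzero_eq_X
  rw [PowerSeries.coeff_X] at h
  rw [← h, PowerSeries.coeff, FormalGroup.Xzero, coeff_subst (hasSubst_pair (map_zero _)),
    finsum_eq_single _ (Finsupp.single 0 i)]
  · rw [coeff_fsum_term]; simp
  · intro d hd
    rw [coeff_fsum_term]
    by_cases h1 : d 1 = 0
    · have : d 0 ≠ i := by
        rintro rfl
        exact hd (by ext j; fin_cases j <;> simp [h1])
      simp [h1, PowerSeries.coeff_X_pow, this.symm]
    · simp [h1]

/-- Every commutative formal group law is the image of the universal one under a unique ring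
homomorphism. -/
theorem lazardLaw_universal {S : Type*} [CommRing S] (G : FormalGroup S) [hG : G.IsComm] :
    ∃! f : LazardRing →+* S, lazardLaw.map f = G := by
  have hsymm (i : ℕ) : coeff (Finsupp.single 1 i) G.toPowerSeries = if i = 1 then 1 else 0 := by
    have h := congrArg (PowerSeries.coeff i) G.zeroX_eq_X
    have e : G.zeroX = G.Xzero :=
      G.comm' PowerSeries.HasSubst.zero PowerSeries.HasSubst.X'
    have hz : HasSubst ![(0 : PowerSeries S), PowerSeries.X] := HasSubst.zero_X
    rw [PowerSeries.coeff_X] at h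
    rw [← h, PowerSeries.coeff, FormalGroup.zeroX, coeff_subst hz,
      finsum_eq_single _ (Finsupp.single 1 i)]
    · rw [smul_eq_mul, Finsupp.prod_fintype _ _ (by simp)]
      have := PowerSeries.coeff_X_pow (R := S) i i
      rw [PowerSeries.coeff] at this
      simp [Fin.prod_univ_two, this]
    · intro d hd
      rw [smul_eq_mul, Finsupp.prod_fintype _ _ (by simp)]
      by_cases h1 : d 0 = 0
      · have h2 : d 1 ≠ i := by
          rintro rfl
          exact hd (by ext j; fin_cases j <;> simp [h1])
        have := PowerSeries.coeff_X_pow (R := S) i (d 1)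
        rw [PowerSeries.coeff] at this
        simp [Fin.prod_univ_two, h1, this, h2.symm]
      · simp [Fin.prod_univ_two, h1]
  let f₀ : MvPolynomial (ℕ+ × ℕ+) ℤ →+* S := MvPolynomial.eval₂Hom (Int.castRingHom S)
    (fun p => coeff (Finsupp.single 0 (p.1 : ℕ) + Finsupp.single 1 (p.2 : ℕ)) G.toPowerSeries)
  have hd (d : Fin 2 →₀ ℕ) : d = Finsupp.single 0 (d 0) + Finsupp.single 1 (d 1) := by
    ext j; fin_cases j <;> simp
  have hf₀ : genericSeries.map f₀ = G.toPowerSeries := by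
    ext d
    rw [coeff_map, genericSeries, map_add, map_add (coeff d), coeff_X, coeff_X, coeff_genericTail]
    by_cases h : 0 < d 0 ∧ 0 < d 1
    · have h0 : d ≠ Finsupp.single 0 1 := by
        intro e; have := h.2; rw [e] at this; simp at this
      have h1 : d ≠ Finsupp.single 1 1 := by
        intro e; have := h.1; rw [e] at this; simp at this
      rw [if_neg h0, if_neg h1, dif_pos h]
      simp only [f₀, zero_add, MvPolynomial.coe_eval₂Hom, MvPolynomial.eval₂_X, Nat.toPNat, PNat.mk_coe]
      rw [← hd]
    · rw [dif_neg h]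
      rcases Nat.eq_zero_or_pos (d 1) with h1 | h1
      · have e : d = Finsupp.single 0 (d 0) := by
          conv_lhs => rw [hd d, h1]
          simp
        rw [e, coeff_single_zero]
        by_cases h2 : d 0 = 1 <;> simp [h2, Finsupp.single_eq_single_iff]
      · have h0 : d 0 = 0 := by omega
        have e : d = Finsupp.single 1 (d 1) := by
          conv_lhs => rw [hd d, h0]
          simp
        rw [e, hsymm]
        by_cases h2 : d 1 = 1 <;> simp [h2, Finsupp.single_eq_single_iff]
  have hker : ∀ a ∈ lazardIdeal, f₀ a = 0 := by
    intro a ha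
    refine (Ideal.span_le (I := RingHom.ker f₀)).2 ?_ ha
    rintro _ (⟨d, rfl⟩ | ⟨d, rfl⟩)
    · change f₀ _ = 0
      rw [← coeff_map, map_sub, map_subst HasSubst.X_X, map_pair, map_X, map_X, hf₀,
        ← FormalGroup.IsComm.comm, sub_self, map_zero]
    · change f₀ _ = 0
      rw [← coeff_map, map_sub,
        map_subst (HasSubst.cons_subst_zero_left (0 : Fin 3) 1 2 constantCoeff_genericSeries),
        map_subst (HasSubst.cons_subst_zero_right (0 : Fin 3) 1 2 constantCoeff_genericSeries),
        map_pair, map_pair, map_subst HasSubst.X_X, map_subst HasSubst.X_X, map_pair, map_pair,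
        map_X, map_X, map_X, hf₀, G.assoc, sub_self, map_zero]
  refine ⟨Ideal.Quotient.lift lazardIdeal f₀ hker, ?_, ?_⟩
  · ext1
    rw [← hf₀]
    ext d
    simp [lazardLaw, FormalGroup.map]
  · intro g hg
    refine Ideal.Quotient.ringHom_ext (MvPolynomial.ringHom_ext' (RingHom.ext_int _ _) ?_)
    intro p
    have h := congrArg (fun H : FormalGroup S =>
      coeff (Finsupp.single 0 (p.1 : ℕ) + Finsupp.single 1 (p.2 : ℕ)) H.toPowerSeries) hg
    have hp : coeff (Finsupp.single 0 (p.1 : ℕ) + Finsupp.single 1 (p.2 : ℕ)) genericSeries =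
        MvPolynomial.X p := by
      have h0 : (Finsupp.single 0 (p.1 : ℕ) + Finsupp.single 1 (p.2 : ℕ) : Fin 2 →₀ ℕ) ≠
          Finsupp.single 0 1 := by
        intro e; have := DFunLike.congr_fun e 1; simp at this
      have h1 : (Finsupp.single 0 (p.1 : ℕ) + Finsupp.single 1 (p.2 : ℕ) : Fin 2 →₀ ℕ) ≠
          Finsupp.single 1 1 := by
        intro e; have := DFunLike.congr_fun e 0; simp at this
      rw [genericSeries, map_add, map_add, coeff_X, coeff_X, coeff_genericTail, if_neg h0,
        if_neg h1]
      simp [Nat.toPNat]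
      rfl
    simp only [FormalGroup.map, lazardLaw, coeff_map, hp] at h
    simp [f₀, h]

end Lazard

/-! ### The new universal Schur functions -/

section Schur

/-- The coefficient `a_{i,j}` of `u^i v^j` in the universal formal group law. -/
def lazardCoeff (i j : ℕ) : LazardRing :=
  coeff (Finsupp.single 0 i + Finsupp.single 1 j) lazardLaw.toPowerSeries

/-- The ring `𝕃[[x_1, …, x_n]]`. -/
abbrev XSeries (n : ℕ) : Type := MvPowerSeries (Fin n) LazardRing

/-- The total ring of fractions of `𝕃[[x_1, …, x_n]]`. -/
abbrev XFrac (n : ℕ) : Type := FractionRing (XSeries n)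

/-- The series `x_i +_𝕃 x̄_j`. -/
def xDiff {n : ℕ} (i j : Fin n) : XSeries n :=
  fsum lazardLaw (X i) (finv lazardLaw (X j))

/-- For a partition `lam = (lam_1 ≥ … ≥ lam_n ≥ 0)`, the image under `w` of
`x^[lam] / ∏_{i < j, n(i) < n(j)} (x_i +_𝕃 x̄_j)`. Here `n(i) < n(j)` means `lam_i > lam_j`
(which forces `i < j`), and the exponent of `x_i` in `x^[lam]`, for `i` in the `r`-th interval
on which `lam` is constant, is `lam_i` plus the number `n - ν(r)` of indices in later intervals. -/
def schurTerm {n : ℕ} (lam : Fin n → ℕ) (w : Equiv.Perm (Fin n)) : XFrac n :=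
  algebraMap (XSeries n) (XFrac n)
      (∏ i, X (w i) ^ (lam i + (Finset.univ.filter fun j => lam j < lam i).card)) *
    Ring.inverse (algebraMap (XSeries n) (XFrac n)
      (∏ p : Fin n × Fin n with lam p.2 < lam p.1, xDiff (w p.1) (w p.2)))

/-- The stabilizer `S_n^lam` of `lam` in `S_n`. -/
def stab {n : ℕ} (lam : Fin n → ℕ) : Subgroup (Equiv.Perm (Fin n)) where
  carrier := {s | ∀ i, lam (s i) = lam i}
  one_mem' _ := rfl
  mul_mem' {s t} hs ht i := by
    rw [Equiv.Perm.mul_apply]; exact (hs _).trans (ht i)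
  inv_mem' {s} hs i := by
    have h := hs (s⁻¹ i)
    have h' : s (s⁻¹ i) = i := s.apply_symm_apply i
    rw [h'] at h
    exact h.symm

theorem schurTerm_mul {n : ℕ} (lam : Fin n → ℕ) (w s : Equiv.Perm (Fin n)) (hs : s ∈ stab lam) :
    schurTerm lam (w * s) = schurTerm lam w := by
  have hs' : ∀ i, lam (s i) = lam i := hs
  have h₁ : (∏ i, (X ((w * s) i) : XSeries n) ^
        (lam i + (Finset.univ.filter fun j => lam j < lam i).card)) =
      ∏ i, (X (w i) : XSeries n) ^
        (lam i + (Finset.univ.filter fun j => lam j < lam i).card) := by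
    rw [← Equiv.prod_comp s (fun i =>
      (X (w i) : XSeries n) ^ (lam i + (Finset.univ.filter fun j => lam j < lam i).card))]
    simp only [hs', Equiv.Perm.mul_apply]
  have h₂ : (∏ p : Fin n × Fin n with lam p.2 < lam p.1,
        xDiff ((w * s) p.1) ((w * s) p.2)) =
      ∏ p : Fin n × Fin n with lam p.2 < lam p.1, xDiff (w p.1) (w p.2) :=
    Finset.prod_equiv (Equiv.prodCongr s s) (fun p => by simp [hs']) (fun p _ => rfl)
  rw [schurTerm, schurTerm, h₁, h₂]

/-- The new universal Schur function `S^𝕃_lam(x_1, …, x_n)`: the sum of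
`w · [x^[lam] / ∏_{i < j, n(i) < n(j)} (x_i +_𝕃 x̄_j)]` over the cosets in `S_n / S_n^lam`. -/
def newSchur {n : ℕ} (lam : Fin n → ℕ) : XFrac n :=
  ∑ᶠ c : Equiv.Perm (Fin n) ⧸ stab lam,
    Quotient.liftOn' c (schurTerm lam) fun w w' h => by
      have := schurTerm_mul lam w (w⁻¹ * w') (QuotientGroup.leftRel_apply.1 h)
      rw [mul_inv_cancel_left] at this
      exact this.symm

/-- The one-row partition `(k) = (k, 0, …, 0)`. -/
def oneRow (n k : ℕ) : Fin n → ℕ := fun i => if i.val = 0 then k else 0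

/-- The sum `∑_i x_i^(k + n - 1) / ∏_{j ≠ i} (x_i +_𝕃 x̄_j)`, for `k ≥ 1 - n`. -/
def rowSum (n : ℕ) (k : ℤ) : XFrac n :=
  ∑ i : Fin n, algebraMap (XSeries n) (XFrac n) (X i ^ (k + n - 1).toNat) *
    Ring.inverse (algebraMap (XSeries n) (XFrac n)
      (∏ j ∈ Finset.univ.erase i, xDiff i j))

/-- The ring `𝕃((t))[[x_1, …, x_n]]`. Its elements are the Laurent series
`∑_{k ∈ ℤ} c_k t^k` with `c_k ∈ 𝕃[[x_1, …, x_n]]` such that every monomial in the `x_i` occurs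
in `c_k` for only finitely many `k < 0`; so `(t - x)⁻¹ = ∑_{m ≥ 0} x^m t^(-m-1)` in it. -/
abbrev TSeries (n : ℕ) : Type := MvPowerSeries (Fin n) (LaurentSeries LazardRing)

/-- The coefficient `c_k ∈ 𝕃[[x_1, …, x_n]]` of `t^k`. -/
def tCoeff {n : ℕ} (k : ℤ) (f : TSeries n) : XSeries n := fun d => (coeff d f).coeff k

/-- The power `t^k`, for `k ∈ ℤ`. -/
def tPow (n : ℕ) (k : ℤ) : TSeries n := C (HahnSeries.single k 1)

/-- A power series in `t` as an element of `𝕃((t))[[x_1, …, x_n]]`. -/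
def ofPowerSeriesT (n : ℕ) (f : PowerSeries LazardRing) : TSeries n :=
  C (HahnSeries.ofPowerSeries ℤ LazardRing f)

/-- The inclusion of `𝕃[[t, x_1, …, x_n]]`, where `t` is the variable `none`. -/
def incl (n : ℕ) (f : MvPowerSeries (Option (Fin n)) LazardRing) : TSeries n := fun d =>
  HahnSeries.ofPowerSeries ℤ LazardRing (PowerSeries.mk fun k => coeff (d.optionElim k) f)

/-- `(1 + ∑_{i ≥ 1} a_{i,1} t^i) ∏_i (t +_𝕃 x̄_i)`. -/
def residueDenom (n : ℕ) : TSeries n :=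
  ofPowerSeriesT n (1 + PowerSeries.mk fun i => if 1 ≤ i then lazardCoeff i 1 else 0) *
    ∏ i : Fin n, incl n (fsum lazardLaw (X none) (finv lazardLaw (X (some i))))

/-- `Res_{t=0} t^(k+n-1) dt / ((1 + ∑_{i ≥ 1} a_{i,1} t^i) ∏_i (t +_𝕃 x̄_i))`. -/
def rowResidue (n : ℕ) (k : ℤ) : XSeries n :=
  tCoeff (-1) (tPow n (k + n - 1) * Ring.inverse (residueDenom n))

/-- The one-row new universal Schur function `S^𝕃_k(x_1, …, x_n)`, for `k ∈ ℤ`: it is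
`S^𝕃_(k)` for `k ≥ 1`, is given by the same sum over `i` for `1 - n ≤ k ≤ 0`, and by the
residue for `k < 1 - n`, where that sum would have negative exponents. -/
def rowSchur (n : ℕ) (k : ℤ) : XFrac n :=
  if 1 ≤ k then newSchur (oneRow n k.toNat)
  else if 1 - (n : ℤ) ≤ k then rowSum n k
  else algebraMap (XSeries n) (XFrac n) (rowResidue n k)

end Schur

end UniversalSchur

end

open UniversalSchur

/-!
Over any commutative ring `R` and for any commutative formal group law `F` there is a factorization
`u +_F [-1]_F(v) = (u - v) G(u, v)` with `G(0, 0) = 1`, because the left side vanishes at `u = v`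
(`fsum_finv_eq`, `constantCoeff_diffQuot`). On the diagonal `G(u, u) p(u) = 1`, where
`p(u) = 1 + ∑_{i ≥ 1} a_{i,1} u^i` (`partialSnd_mul_diffQuot`): write `F(u, w) = u + w P(u, w)`, so
that `P(u, 0) = p(u)`; the group laws give
`w = F(F(u, w), [-1]_F(u)) = w P(u, w) G(F(u, w), u)`, and one cancels `w` and sets `w = 0`.

Since `u - v` is not a zero divisor and `G` is a unit, the denominators `x_i +_F [-1]_F(x_j)` become
invertible in the total ring of fractions. The denominator `p(t) ∏_i (t +_F [-1]_F(x_i))` equals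
`h(t) ∏_i (t - x_i)` with `h(t) = p(t) ∏_i G(t, x_i)` a unit of `R[[t, x]]`, and `t - x_i` is
invertible in `R((t))[[x]]`.

The coefficients to be computed are the residues of `f(t) dt / ∏_i (t - x_i)` for
`f(t) = t^m / h(t)`. For a finite set `S` of indices, the residue of `f(t) dt / ∏_{i ∈ S} (t - x_i)`
is `f(x_i)` for `S = {i}`, and it satisfies the recursion of divided differences coming from
`(x_a - x_b) / ((t - x_a) (t - x_b)) = 1 / (t - x_a) - 1 / (t - x_b)`. Hence it is
`∑_{i ∈ S} f(x_i) / ∏_{j ∈ S, j ≠ i} (x_i - x_j)` (`eq_divDiff`). Because `p(x_i) G(x_i, x_i) = 1`,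
one has `h(x_i) = ∏_{j ≠ i} G(x_i, x_j)`, and the sum turns into
`∑_i x_i^m / ∏_{j ≠ i} (x_i +_F [-1]_F(x_j))` (`algebraMap_residue_eq_sum`). For `k ≥ 1` this is the
Schur function of `(k)`, the cosets of the stabilizer being indexed by the image of the first
index (`newSchur_oneRow`).

The argument is carried out over a general coefficient ring and specialized to the Lazard ring only
at the end.
-/

noncomputable section

namespace UniversalSchur

open MvPowerSeries

/-! ### Divisibility by a difference of two variables -/

section Division

variable {R : Type*} [CommRing R] {σ τ : Type*}

theorem constantCoeff_subst_of_constantCoeff_zero [Finite σ] {a : σ → MvPowerSeries τ R}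
    (ha : ∀ s, constantCoeff (a s) = 0) (f : MvPowerSeries σ R) :
    constantCoeff (subst a f) = constantCoeff f := by
  have hs := hasSubst_of_constantCoeff_zero ha
  have h := constantCoeff_subst_eq_zero hs ha (f := f - C (constantCoeff f)) (by simp)
  rw [subst_sub hs, subst_C, map_sub, constantCoeff_C] at h
  exact sub_eq_zero.1 h

theorem constantCoeff_update_X [DecidableEq σ] {s : σ} {g : MvPowerSeries σ R}
    (hg : constantCoeff g = 0) (i : σ) :
    constantCoeff (Function.update (X : σ → MvPowerSeries σ R) s g i) = 0 := by
  by_cases h : i = s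
  · subst h; simpa
  · simp [h]

theorem subst_update_X_update_X [Finite σ] [DecidableEq σ] {s : σ}
    {g h : MvPowerSeries σ R} (hg : constantCoeff g = 0) (hh : constantCoeff h = 0)
    (hgh : subst (Function.update X s h) g = X s) (f : MvPowerSeries σ R) :
    subst (Function.update X s h) (subst (Function.update X s g) f) = f := by
  have hb := hasSubst_of_constantCoeff_zero (constantCoeff_update_X (s := s) hh)
  rw [subst_comp_subst_apply
    (hasSubst_of_constantCoeff_zero (constantCoeff_update_X (s := s) hg)) hb]
  have : (fun i => subst (Function.update X s h)
      (Function.update (X : σ → MvPowerSeries σ R) s g i)) = X := by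
    funext i
    by_cases hi : i = s
    · subst hi
      rw [Function.update_self, hgh]
    · rw [Function.update_of_ne hi, subst_X hb, Function.update_of_ne hi]
  rw [this, subst_self, id]

/-- The shear `X s ↦ X s + X r` is an automorphism taking `X s - X r` to `X s`; following it by
`X s ↦ 0` gives the substitution `X s ↦ X r`. -/
theorem exists_shear [Finite σ] [DecidableEq σ] {s r : σ} (hsr : s ≠ r) :
    ∃ e : MvPowerSeries σ R ≃ₐ[R] MvPowerSeries σ R, e (X s - X r) = X s ∧
      ∀ f, rescale (Function.update 1 s 0) (e f) = rename (Function.update id s r) f := by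
  have hp : constantCoeff (X s + X r : MvPowerSeries σ R) = 0 := by simp
  have hm : constantCoeff (X s - X r : MvPowerSeries σ R) = 0 := by simp
  have ha := hasSubst_of_constantCoeff_zero (constantCoeff_update_X (s := s) hp)
  have hb := hasSubst_of_constantCoeff_zero (constantCoeff_update_X (s := s) hm)
  refine ⟨AlgEquiv.ofAlgHom (substAlgHom ha) (substAlgHom hb) ?_ ?_, ?_, ?_⟩
  · ext1 f
    rw [AlgHom.comp_apply, coe_substAlgHom, coe_substAlgHom, AlgHom.id_apply]
    refine subst_update_X_update_X hm hp ?_ f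
    rw [subst_sub ha, subst_X ha, subst_X ha, Function.update_self,
      Function.update_of_ne hsr.symm, add_sub_cancel_right]
  · ext1 f
    rw [AlgHom.comp_apply, coe_substAlgHom, coe_substAlgHom, AlgHom.id_apply]
    refine subst_update_X_update_X hp hm ?_ f
    rw [subst_add hb, subst_X hb, subst_X hb, Function.update_self,
      Function.update_of_ne hsr.symm, sub_add_cancel]
  · rw [AlgEquiv.ofAlgHom_apply, coe_substAlgHom, subst_sub ha, subst_X ha, subst_X ha,
      Function.update_self, Function.update_of_ne hsr.symm, add_sub_cancel_right]
  · intro f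
    have hc := HasSubst.smul_X (R := R) (Function.update (1 : σ → R) s 0)
    rw [AlgEquiv.ofAlgHom_apply, coe_substAlgHom, rescale_eq_subst, subst_comp_subst_apply ha hc,
      rename_eq_subst]
    congr 1
    funext i
    by_cases h : i = s
    · subst h
      rw [Function.update_self, subst_add hc, subst_X hc, subst_X hc]
      simp [hsr.symm]
    · rw [Function.update_of_ne h, subst_X hc]
      simp [h]

/-- The factor theorem: a power series that vanishes under `X s ↦ X r` is a multiple of
`X s - X r`. -/
theorem X_sub_X_dvd [Finite σ] [DecidableEq σ] {s r : σ} (hsr : s ≠ r) {f : MvPowerSeries σ R}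
    (hf : rename (Function.update id s r) f = 0) : X s - X r ∣ f := by
  obtain ⟨e, he, hr⟩ := exists_shear (R := R) hsr
  rw [← map_dvd_iff e, he, X_dvd_iff]
  intro m hm
  -- setting `X s` to zero does not change a coefficient whose exponent at `s` is zero
  have := congrArg (coeff m) ((hr f).trans hf)
  rw [coeff_rescale, Finsupp.prod, Finset.prod_eq_one, one_mul] at this
  · simpa using this
  · intro i hi
    have : i ≠ s := by
      rintro rfl
      simp [hm] at hi
    simp [this]

theorem X_sub_X_mem_nonZeroDivisors [Finite σ] {s r : σ} (hsr : s ≠ r) :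
    (X s - X r : MvPowerSeries σ R) ∈ nonZeroDivisors (MvPowerSeries σ R) := by
  classical
  obtain ⟨e, he, -⟩ := exists_shear (R := R) hsr
  rw [mem_nonZeroDivisors_iff_right]
  intro f hf
  have h : e f * X s = 0 := by rw [← he, ← map_mul, hf, map_zero]
  have hX : (X s : MvPowerSeries σ R) ∈ nonZeroDivisors (MvPowerSeries σ R) :=
    X_mem_nonzeroDivisors
  have h' : e f = 0 := (mul_right_mem_nonZeroDivisors_eq_zero_iff hX).1 h
  rw [← e.symm_apply_apply f, h', map_zero]

end Division

/-! ### The factorization of `u +_F [-1]_F(v)` -/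

section FormalGroup

variable {R : Type*} [CommRing R] (F : FormalGroup R) {σ τ : Type*}

theorem hasSubst_cons {f g : MvPowerSeries σ R} (hf : constantCoeff f = 0)
    (hg : constantCoeff g = 0) : HasSubst ![f, g] :=
  hasSubst_of_constantCoeff_zero fun s => by fin_cases s <;> simpa

theorem constantCoeff_finv {f : MvPowerSeries σ R} (hf : constantCoeff f = 0) :
    constantCoeff (finv F f) = 0 := by
  rw [finv, PowerSeries.subst, constantCoeff_subst_of_constantCoeff_zero fun _ => hf]
  exact constantCoeff_formalInverse F

theorem subst_fsum [Finite σ] {a : σ → MvPowerSeries τ R} (ha : ∀ s, constantCoeff (a s) = 0)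
    {f g : MvPowerSeries σ R} (hf : constantCoeff f = 0) (hg : constantCoeff g = 0) :
    subst a (fsum F f g) = fsum F (subst a f) (subst a g) := by
  rw [fsum, subst_comp_subst_apply (hasSubst_cons hf hg) (hasSubst_of_constantCoeff_zero ha), fsum]
  congr 1
  funext i
  fin_cases i <;> rfl

theorem subst_finv [Finite σ] {a : σ → MvPowerSeries τ R} (ha : ∀ s, constantCoeff (a s) = 0)
    {f : MvPowerSeries σ R} (hf : constantCoeff f = 0) :
    subst a (finv F f) = finv F (subst a f) := by
  rw [finv, PowerSeries.subst, subst_comp_subst_apply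
    (hasSubst_of_constantCoeff_zero fun _ => hf) (hasSubst_of_constantCoeff_zero ha)]
  rfl

theorem fsum_finv {f : MvPowerSeries σ R} (hf : constantCoeff f = 0) :
    fsum F f (finv F f) = 0 := by
  have hs : HasSubst (fun _ : Unit => f) := hasSubst_of_constantCoeff_zero fun _ => hf
  have h := congrArg (subst fun _ : Unit => f) (fsum_formalInverse F)
  rw [subst_fsum F (fun _ => hf) PowerSeries.constantCoeff_X (constantCoeff_formalInverse F),
    ← coe_substAlgHom hs, map_zero, coe_substAlgHom hs, PowerSeries.X, subst_X hs] at h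
  exact h

theorem finv_zero : finv F (0 : MvPowerSeries σ R) = 0 := by
  rw [finv, PowerSeries.subst]
  exact subst_zero_of_constantCoeff_zero (constantCoeff_formalInverse F)

theorem exists_fsum_finv_eq :
    ∃ G : MvPowerSeries (Fin 2) R, fsum F (X 0) (finv F (X 1)) = (X 0 - X 1) * G := by
  refine X_sub_X_dvd (by decide) ?_
  have hX : ∀ i : Fin 2,
      constantCoeff ((X ∘ Function.update id 0 1) i : MvPowerSeries (Fin 2) R) = 0 :=
    fun i => by simp
  rw [rename_eq_subst, subst_fsum F hX (by simp) (constantCoeff_finv F (by simp)),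
    subst_finv F hX (by simp), subst_X (hasSubst_of_constantCoeff_zero hX),
    subst_X (hasSubst_of_constantCoeff_zero hX)]
  exact fsum_finv F (by simp)

/-- The power series `G(u, v)` with `u +_F [-1]_F(v) = (u - v) G(u, v)`, as a series in the
variables `u = X 0` and `v = X 1`. -/
def diffQuot : MvPowerSeries (Fin 2) R := (exists_fsum_finv_eq F).choose

theorem fsum_finv_eq {f h : MvPowerSeries σ R} (hf : constantCoeff f = 0)
    (hh : constantCoeff h = 0) :
    fsum F f (finv F h) = (f - h) * (diffQuot F).subst ![f, h] := by
  have hc : ∀ s, constantCoeff (![f, h] s) = 0 := fun s => by fin_cases s <;> simpa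
  have hs := hasSubst_cons hf hh
  have := congrArg (subst ![f, h]) (exists_fsum_finv_eq F).choose_spec
  rw [subst_fsum F hc (by simp) (constantCoeff_finv F (by simp)), subst_finv F hc (by simp),
    subst_mul hs, subst_sub hs, subst_X hs, subst_X hs] at this
  exact this

/-- `G(0, 0) = 1`, since `u = u +_F [-1]_F(0) = u G(u, 0)`. -/
theorem constantCoeff_diffQuot : constantCoeff (diffQuot F) = 1 := by
  have h := fsum_finv_eq F (σ := Unit) (f := X ()) (h := 0) (by simp) (by simp)
  rw [finv_zero, fsum, F.add_zero (PowerSeries.HasSubst.of_constantCoeff_zero (constantCoeff_X ())),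
    sub_zero] at h
  have h1 : (diffQuot F).subst ![X (), (0 : MvPowerSeries Unit R)] = 1 := by
    have := (mul_cancel_left_mem_nonZeroDivisors
      (X_mem_nonzeroDivisors (R := R) (i := ()))).1 (h.symm.trans (mul_one _).symm)
    exact this
  rw [← constantCoeff_subst_of_constantCoeff_zero (a := ![X (), (0 : MvPowerSeries Unit R)])
    (fun s => by fin_cases s <;> simp), h1, map_one]

theorem isUnit_subst_diffQuot {f h : MvPowerSeries σ R} (hf : constantCoeff f = 0)
    (hh : constantCoeff h = 0) : IsUnit ((diffQuot F).subst ![f, h]) := by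
  rw [isUnit_iff_constantCoeff, constantCoeff_subst_of_constantCoeff_zero
    (fun s => by fin_cases s <;> simpa), constantCoeff_diffQuot]
  exact isUnit_one

theorem coeff_subst_X_zero (f : MvPowerSeries (Fin 2) R) (i : ℕ) :
    PowerSeries.coeff i (f.subst ![PowerSeries.X, (0 : PowerSeries R)]) =
      coeff (Finsupp.single 0 i) f := by
  rw [PowerSeries.coeff, coeff_subst (hasSubst_pair (map_zero _)),
    finsum_eq_single _ (Finsupp.single 0 i)]
  · rw [coeff_fsum_term]; simp
  · intro d hd
    rw [coeff_fsum_term]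
    by_cases h1 : d 1 = 0
    · have : d 0 ≠ i := by
        rintro rfl
        exact hd (by ext j; fin_cases j <;> simp [h1])
      simp [h1, PowerSeries.coeff_X_pow, this.symm]
    · simp [h1]

/-- The series `p(t) = 1 + ∑_{i ≥ 1} a_{i,1} t^i`, the partial derivative `∂F/∂v` at `(t, 0)`. -/
def partialSnd : PowerSeries R :=
  1 + PowerSeries.mk fun i => if 1 ≤ i then
    coeff (Finsupp.single 0 i + Finsupp.single 1 1) F.toPowerSeries else 0

theorem coeff_partialSnd (i : ℕ) : PowerSeries.coeff i (partialSnd F) =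
    coeff (Finsupp.single 0 i + Finsupp.single 1 1) F.toPowerSeries := by
  rcases Nat.eq_zero_or_pos i with rfl | hi
  · simp [partialSnd, F.lin_coeff_Y]
  · simp [partialSnd, PowerSeries.coeff_one, hi.ne', Nat.one_le_iff_ne_zero]

/-- `p(u) G(u, u) = 1`; that is, `du / p(u)` is the invariant differential of `F`. -/
theorem partialSnd_mul_diffQuot [F.IsComm] :
    partialSnd F * (diffQuot F).subst ![PowerSeries.X, (PowerSeries.X : PowerSeries R)] = 1 := by
  -- `F(u, w) = u + w P(u, w)`
  obtain ⟨P, hP⟩ : (X 1 : MvPowerSeries (Fin 2) R) ∣ F.toPowerSeries - X 0 := by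
    rw [X_dvd_iff]
    intro m hm
    have e : m = Finsupp.single 0 (m 0) := by
      ext j; fin_cases j <;> simp [hm]
    rw [e, map_sub, coeff_single_zero, coeff_X]
    simp [Finsupp.single_eq_single_iff]
  have hX (i : Fin 2) : PowerSeries.HasSubst (X i : MvPowerSeries (Fin 2) R) :=
    PowerSeries.HasSubst.of_constantCoeff_zero (by simp)
  have hχ : constantCoeff (finv F (X 0 : MvPowerSeries (Fin 2) R)) = 0 :=
    constantCoeff_finv F (by simp)
  have hF : F.toPowerSeries.subst ![X 0, (X 1 : MvPowerSeries (Fin 2) R)] = F.toPowerSeries := by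
    have : ![X 0, (X 1 : MvPowerSeries (Fin 2) R)] = X := by
      funext i; fin_cases i <;> rfl
    rw [this, subst_self, id]
  -- `F(F(u, w), χ(u)) = w` by associativity and commutativity
  have h1 : fsum F F.toPowerSeries (finv F (X 0)) = X 1 := by
    rw [fsum]
    have e : ![F.toPowerSeries, finv F (X 0)] =
        ![F.toPowerSeries.subst ![X 0, (X 1 : MvPowerSeries (Fin 2) R)], finv F (X 0)] := by
      rw [hF]
    rw [e,  F.comm' (hX 0) (hX 1), F.assoc' (hX 1) (hX 0)
      (PowerSeries.HasSubst.of_constantCoeff_zero hχ)]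
    have := fsum_finv F (σ := Fin 2) (f := X 0) (by simp)
    rw [fsum] at this
    rw [this, F.add_zero (hX 1)]
  rw [fsum_finv_eq F F.zero_constantCoeff (by simp), hP, mul_assoc] at h1
  have h2 := (mul_cancel_left_mem_nonZeroDivisors
      (X_mem_nonzeroDivisors (R := R) (i := (1 : Fin 2)))).1 (h1.trans (mul_one _).symm)
  -- set `w = 0`
  have hs : HasSubst ![(PowerSeries.X : PowerSeries R), 0] := hasSubst_pair (map_zero _)
  have h3 := congrArg (subst ![(PowerSeries.X : PowerSeries R), 0]) h2
  rw [subst_mul hs, subst_comp_subst_apply (hasSubst_cons F.zero_constantCoeff (by simp)) hs,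
    ← coe_substAlgHom hs, map_one, coe_substAlgHom hs] at h3
  have h4 : (fun s => subst ![(PowerSeries.X : PowerSeries R), 0]
      (![F.toPowerSeries, (X 0 : MvPowerSeries (Fin 2) R)] s)) =
      ![PowerSeries.X, PowerSeries.X] := by
    funext s
    fin_cases s
    · exact F.Xzero_eq_X
    · simp [subst_X hs]
  have h5 : subst ![(PowerSeries.X : PowerSeries R), 0] P = partialSnd F := by
    ext i
    rw [coeff_subst_X_zero, coeff_partialSnd]
    have := congrArg (coeff (Finsupp.single 0 i + Finsupp.single 1 1)) hP
    rw [map_sub, add_comm, X_def 1, coeff_add_monomial_mul, one_mul, coeff_X, if_neg,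
      sub_zero] at this
    · rw [← this, add_comm]
    · intro e; have := DFunLike.congr_fun e 1; simp at this
  rw [h4, h5] at h3
  exact h3

end FormalGroup

/-! ### The ring `R((t))[[x]]` -/

section Incl

variable {σ R : Type*} [CommRing R]

/-- The coefficient in `R[[x]]` of `t^k`; over the Lazard ring this is `tCoeff` by definition. -/
def laurentCoeff (k : ℤ) (f : MvPowerSeries σ (LaurentSeries R)) : MvPowerSeries σ R :=
  fun d => (coeff d f).coeff k

variable (σ R) in
/-- The power `t^k`, for `k ∈ ℤ`, in `R((t))[[x]]`. -/
def laurentMonomial (k : ℤ) : MvPowerSeries σ (LaurentSeries R) := C (HahnSeries.single k 1)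

/-- The inclusion of `R[[t, x]]` in `R((t))[[x]]`, where `t` is the variable `none`. -/
def laurentInclFun (f : MvPowerSeries (Option σ) R) : MvPowerSeries σ (LaurentSeries R) := fun d =>
  HahnSeries.ofPowerSeries ℤ R (PowerSeries.mk fun k => coeff (d.optionElim k) f)

theorem coeff_laurentInclFun (f : MvPowerSeries (Option σ) R) (d : σ →₀ ℕ) :
    coeff d (laurentInclFun f) =
      HahnSeries.ofPowerSeries ℤ R (PowerSeries.mk fun k => coeff (d.optionElim k) f) :=
  rfl

theorem coeff_laurentCoeff (k : ℤ) (f : MvPowerSeries σ (LaurentSeries R)) (d : σ →₀ ℕ) :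
    coeff d (laurentCoeff k f) = (coeff d f).coeff k := rfl

theorem laurentCoeff_add (k : ℤ) (f g : MvPowerSeries σ (LaurentSeries R)) :
    laurentCoeff k (f + g) = laurentCoeff k f + laurentCoeff k g := by
  ext1 d
  simp [coeff_laurentCoeff]

theorem laurentCoeff_sub (k : ℤ) (f g : MvPowerSeries σ (LaurentSeries R)) :
    laurentCoeff k (f - g) = laurentCoeff k f - laurentCoeff k g := by
  ext1 d
  simp [coeff_laurentCoeff]

theorem laurentCoeff_one (k : ℤ) :
    laurentCoeff k (1 : MvPowerSeries σ (LaurentSeries R)) = if k = 0 then 1 else 0 := by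
  classical
  ext1 d
  rw [coeff_laurentCoeff, coeff_one]
  split_ifs <;> simp_all [coeff_one, HahnSeries.coeff_one]

theorem laurentCoeff_laurentMonomial_mul (k l : ℤ) (f : MvPowerSeries σ (LaurentSeries R)) :
    laurentCoeff k (laurentMonomial σ R l * f) = laurentCoeff (k - l) f := by
  ext1 d
  rw [coeff_laurentCoeff, coeff_laurentCoeff, laurentMonomial, coeff_C_mul,
    HahnSeries.coeff_single_mul, one_mul]

theorem laurentInclFun_add (f g : MvPowerSeries (Option σ) R) :
    laurentInclFun (f + g) = laurentInclFun f + laurentInclFun g := by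
  ext1 d
  rw [map_add, coeff_laurentInclFun, coeff_laurentInclFun, coeff_laurentInclFun, ← map_add]
  rfl

/-- Multiplicativity of the inclusion is read off from `R[[t, x]] ≃ R[[x]][[t]]`. -/
theorem laurentInclFun_mul (f g : MvPowerSeries (Option σ) R) :
    laurentInclFun (f * g) = laurentInclFun f * laurentInclFun g := by
  classical
  ext1 d
  rw [coeff_mul]
  simp only [coeff_laurentInclFun, ← map_mul, ← map_sum]
  congr 1
  ext k
  simp only [PowerSeries.coeff_mk, map_sum, PowerSeries.coeff_mul]
  have h := congrArg (fun p => coeff d (PowerSeries.coeff k p)) (map_mul (optionEquivLeft σ R) f g)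
  simp only [coeff_coeff_optionEquivLeft, PowerSeries.coeff_mul, map_sum, coeff_mul] at h
  rw [Finset.sum_comm, coeff_mul, h]

variable [Finite σ]

theorem coeff_rename_some (c : MvPowerSeries σ R) (d : σ →₀ ℕ) (k : ℕ) :
    coeff (d.optionElim k) (rename some c) = if k = 0 then coeff d c else 0 := by
  split_ifs with hk
  · subst hk
    have : d.optionElim 0 = Finsupp.embDomain Function.Embedding.some d := by
      ext o
      cases o with
      | none => simp [Finsupp.embDomain_of_notMem_range]
      | some i =>
        rw [Finsupp.optionElim_apply_some]
        exact (Finsupp.embDomain_apply_self Function.Embedding.some d i).symm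
    rw [this]
    exact coeff_embDomain_rename Function.Embedding.some c d
  · apply coeff_rename_eq_zero
    rintro ⟨e, he⟩
    have := DFunLike.congr_fun he none
    rw [Finsupp.mapDomain_of_notMem_range _ _ (by simp), Finsupp.optionElim_apply_none] at this
    exact hk this.symm

theorem laurentInclFun_rename_some (c : MvPowerSeries σ R) :
    laurentInclFun (rename some c) = map HahnSeries.C c := by
  ext1 d
  rw [coeff_laurentInclFun, coeff_map, ← HahnSeries.ofPowerSeries_C]
  congr 1
  ext k
  rw [PowerSeries.coeff_mk, coeff_rename_some, PowerSeries.coeff_C]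

theorem laurentInclFun_one : (laurentInclFun 1 : MvPowerSeries σ (LaurentSeries R)) = 1 := by
  rw [← map_one (rename (R := R) (some : σ → Option σ)), laurentInclFun_rename_some, map_one]

/-- The inclusion `R[[t, x]] → R((t))[[x]]` as a ring homomorphism. -/
def laurentIncl : MvPowerSeries (Option σ) R →+* MvPowerSeries σ (LaurentSeries R) :=
  RingHom.mk' ⟨⟨laurentInclFun, laurentInclFun_one⟩, laurentInclFun_mul⟩ laurentInclFun_add

theorem laurentIncl_apply (f : MvPowerSeries (Option σ) R) :
    laurentIncl f = laurentInclFun f := rfl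

theorem C_ofPowerSeries_eq (f : PowerSeries R) :
    (C (HahnSeries.ofPowerSeries ℤ R f) : MvPowerSeries σ (LaurentSeries R)) =
      laurentIncl (rename (fun _ : Unit => none) f) := by
  classical
  let e : Unit ↪ Option σ := ⟨fun _ => none, fun _ _ _ => rfl⟩
  ext1 d
  rw [laurentIncl_apply, coeff_laurentInclFun, coeff_C]
  split_ifs with hd
  · subst hd
    congr 1
    ext k
    have : (0 : σ →₀ ℕ).optionElim k = Finsupp.embDomain e (Finsupp.single () k) := by
      rw [Finsupp.embDomain_single, Finsupp.optionElim_zero]; rfl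
    rw [PowerSeries.coeff_mk, this]
    exact (coeff_embDomain_rename e f _).symm
  · rw [eq_comm, ← map_zero (HahnSeries.ofPowerSeries ℤ R)]
    congr 1
    ext k
    rw [PowerSeries.coeff_mk, map_zero]
    apply coeff_rename_eq_zero
    rintro ⟨u, hu⟩
    apply hd
    ext i
    have := DFunLike.congr_fun hu (some i)
    rw [Finsupp.mapDomain_of_notMem_range _ _ (by simp), Finsupp.optionElim_apply_some] at this
    exact this.symm

theorem laurentIncl_X_none :
    laurentIncl (X none : MvPowerSeries (Option σ) R) = C (HahnSeries.single 1 1) := by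
  rw [← HahnSeries.ofPowerSeries_X]
  have h := C_ofPowerSeries_eq (σ := σ) (R := R) PowerSeries.X
  rw [PowerSeries.X, rename_X] at h
  exact h.symm

theorem laurentMonomial_natCast (m : ℕ) : laurentMonomial σ R m = laurentIncl (X none ^ m) := by
  rw [map_pow, laurentIncl_X_none, laurentMonomial, ← map_pow, HahnSeries.single_pow]
  simp

/-- Extraction of the coefficient of `t^k` is `R[[x]]`-linear. -/
theorem laurentCoeff_rename_some_mul (k : ℤ) (c : MvPowerSeries σ R)
    (f : MvPowerSeries σ (LaurentSeries R)) :
    laurentCoeff k (laurentIncl (rename some c) * f) = c * laurentCoeff k f := by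
  classical
  ext1 d
  rw [laurentIncl_apply, laurentInclFun_rename_some, coeff_laurentCoeff, coeff_mul, coeff_mul,
    HahnSeries.coeff_sum]
  refine Finset.sum_congr rfl fun p _ => ?_
  rw [coeff_map, HahnSeries.C_mul_eq_smul, HahnSeries.coeff_smul, smul_eq_mul, coeff_laurentCoeff]

theorem laurentCoeff_neg_one_laurentIncl (f : MvPowerSeries (Option σ) R) :
    laurentCoeff (-1) (laurentIncl f) = 0 := by
  ext1 d
  rw [laurentIncl_apply, coeff_laurentCoeff, coeff_laurentInclFun, PowerSeries.coeff_coe,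
    if_pos (by norm_num), map_zero]

variable (R) in
/-- The element `t - x_j` of `R((t))[[x]]`. -/
def tSub (j : σ) : MvPowerSeries σ (LaurentSeries R) := laurentIncl (X none - X (some j))

theorem tSub_eq (j : σ) : tSub R j = laurentMonomial σ R 1 - laurentIncl (rename some (X j)) := by
  rw [tSub, map_sub, rename_X, laurentIncl_X_none]; rfl

theorem isUnit_tSub (j : σ) : IsUnit (tSub R j) := by
  rw [isUnit_iff_constantCoeff, tSub_eq, laurentIncl_apply, laurentInclFun_rename_some, map_sub,
    laurentMonomial, constantCoeff_C, constantCoeff_map, constantCoeff_X, map_zero, sub_zero]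
  exact IsUnit.of_mul_eq_one (HahnSeries.single (-1) 1) (by simp [HahnSeries.single_mul_single])

/-- The relation `(t - x_j) (t - x_j)⁻¹ = 1` read off at `t^k`. -/
theorem laurentCoeff_sub_one_inverse_tSub (j : σ) (k : ℤ) :
    laurentCoeff (k - 1) (Ring.inverse (tSub R j)) =
      X j * laurentCoeff k (Ring.inverse (tSub R j)) + if k = 0 then 1 else 0 := by
  have h := congrArg (laurentCoeff k) (Ring.mul_inverse_cancel _ (isUnit_tSub (R := R) j))
  nth_rewrite 1 [tSub_eq] at h
  rw [sub_mul, laurentCoeff_sub, laurentCoeff_laurentMonomial_mul, laurentCoeff_rename_some_mul,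
    laurentCoeff_one] at h
  rw [← h]; ring

/-- The expansion of `(t - x_j)⁻¹` has only negative powers of `t`: by the recursion, a coefficient
of a nonnegative power is divisible by every power of `x_j`. -/
theorem laurentCoeff_natCast_inverse_tSub (j : σ) (k : ℕ) :
    laurentCoeff k (Ring.inverse (tSub R j)) = 0 := by
  have h (m : ℕ) : laurentCoeff k (Ring.inverse (tSub R j)) =
      X j ^ m * laurentCoeff (k + m : ℕ) (Ring.inverse (tSub R j)) := by
    induction m with
    | zero => simp
    | succ m ih =>
      have := laurentCoeff_sub_one_inverse_tSub (R := R) j (k + (m + 1) : ℕ)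
      rw [if_neg (by omega), add_zero] at this
      rw [ih, pow_succ, mul_assoc, ← this]
      congr 3
      push_cast; ring
  ext1 d
  rw [h (d j + 1), map_zero]
  exact X_pow_dvd_iff.1 (dvd_mul_right _ _) d (Nat.lt_succ_self _)

/-- `Res_{t=0} dt / (t - x_j) = 1`. -/
theorem laurentCoeff_neg_one_inverse_tSub (j : σ) :
    laurentCoeff (-1) (Ring.inverse (tSub R j)) = 1 := by
  have h := laurentCoeff_sub_one_inverse_tSub (R := R) j 0
  have h0 := laurentCoeff_natCast_inverse_tSub (R := R) j 0
  rw [Nat.cast_zero] at h0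
  rw [h0, mul_zero, if_pos rfl, zero_add] at h
  exact h

/-! ### Residues and divided differences -/

/-- The substitution `t ↦ x_i` in `R[[t, x]]`. -/
def evalT (i : σ) : MvPowerSeries (Option σ) R →ₐ[R] MvPowerSeries σ R :=
  rename fun o => o.getD i

/-- Division with remainder by `t - x_i`: the remainder of `f` is `f(x_i)`. -/
theorem exists_eq_add_mul_sub (i : σ) (f : MvPowerSeries (Option σ) R) :
    ∃ q, f = rename some (evalT i f) + q * (X none - X (some i)) := by
  obtain ⟨q, hq⟩ : X none - X (some i) ∣ f - rename some (evalT i f) := by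
    classical
    refine X_sub_X_dvd (by simp) ?_
    rw [map_sub, sub_eq_zero, evalT, rename_rename, rename_rename]
    congr 2
    funext o
    cases o <;> simp
  exact ⟨q, by rw [mul_comm, ← hq]; ring⟩

/-- The residue at `t = 0` of `f dt / ∏_{j ∈ S} (t - x_j)`. -/
def residue (f : MvPowerSeries (Option σ) R) (S : Finset σ) : MvPowerSeries σ R :=
  laurentCoeff (-1) (laurentIncl f * ∏ j ∈ S, Ring.inverse (tSub R j))

theorem residue_singleton (f : MvPowerSeries (Option σ) R) (i : σ) :
    residue f {i} = evalT i f := by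
  obtain ⟨q, hq⟩ := exists_eq_add_mul_sub i f
  rw [residue, Finset.prod_singleton]
  nth_rewrite 1 [hq]
  rw [map_add, map_mul, add_mul, laurentCoeff_add, laurentCoeff_rename_some_mul,
    laurentCoeff_neg_one_inverse_tSub, ← tSub, Ring.mul_inverse_cancel_right _ _ (isUnit_tSub i),
    laurentCoeff_neg_one_laurentIncl, mul_one, add_zero]

/-- The recursion comes from the partial fraction decomposition of `1 / ((t - x_a) (t - x_b))`. -/
theorem sub_mul_residue_insert_insert [DecidableEq σ] (f : MvPowerSeries (Option σ) R)
    {S : Finset σ} {a b : σ} (ha : a ∉ S) (hb : b ∉ S) (hab : a ≠ b) :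
    (X a - X b) * residue f (insert a (insert b S)) =
      residue f (insert a S) - residue f (insert b S) := by
  have hab' : laurentIncl (rename some (X a - X b)) = tSub R b - tSub R a := by
    rw [tSub, tSub, ← map_sub, map_sub, rename_X, rename_X]; congr 1; ring
  rw [residue, residue, residue, ← laurentCoeff_rename_some_mul, ← laurentCoeff_sub, hab',
    Finset.prod_insert (by simp [ha, hab]), Finset.prod_insert hb, Finset.prod_insert ha]
  congr 1
  have h1 := Ring.mul_inverse_cancel _ (isUnit_tSub (R := R) a)
  have h2 := Ring.mul_inverse_cancel _ (isUnit_tSub (R := R) b)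
  linear_combination
    (laurentIncl f * (∏ j ∈ S, Ring.inverse (tSub R j)) * Ring.inverse (tSub R a)) * h2 -
    (laurentIncl f * (∏ j ∈ S, Ring.inverse (tSub R j)) * Ring.inverse (tSub R b)) * h1

end Incl

section DividedDifference

variable {ι K : Type*} [DecidableEq ι] [CommRing K]

/-- The divided difference `∑_{i ∈ S} c_i / ∏_{j ∈ S, j ≠ i} (y_i - y_j)`. -/
def divDiff (y c : ι → K) (S : Finset ι) : K :=
  ∑ i ∈ S, c i * ∏ j ∈ S.erase i, Ring.inverse (y i - y j)

theorem divDiff_insert (y c : ι → K) {S : Finset ι} {a : ι} (ha : a ∉ S) :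
    divDiff y c (insert a S) = c a * ∏ j ∈ S, Ring.inverse (y a - y j) +
      ∑ i ∈ S, c i * (Ring.inverse (y i - y a) * ∏ j ∈ S.erase i, Ring.inverse (y i - y j)) := by
  rw [divDiff, Finset.sum_insert ha, Finset.erase_insert ha]
  congr 1
  refine Finset.sum_congr rfl fun i hi => ?_
  have hia : a ≠ i := fun h => ha (h ▸ hi)
  rw [Finset.erase_insert_of_ne hia, Finset.prod_insert fun h => ha (Finset.mem_of_mem_erase h)]

theorem sub_mul_divDiff_insert_insert {y : ι → K} (hy : ∀ i j, i ≠ j → IsUnit (y i - y j))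
    (c : ι → K) {S : Finset ι} {a b : ι} (ha : a ∉ S) (hb : b ∉ S) (hab : a ≠ b) :
    (y a - y b) * divDiff y c (insert a (insert b S)) =
      divDiff y c (insert a S) - divDiff y c (insert b S) := by
  have h1 := Ring.mul_inverse_cancel _ (hy a b hab)
  have h2 := Ring.mul_inverse_cancel _ (hy b a hab.symm)
  rw [divDiff_insert y c (by simp [ha, hab] : a ∉ insert b S), Finset.prod_insert hb,
    Finset.sum_insert hb, Finset.erase_insert hb, divDiff_insert y c ha, divDiff_insert y c hb,
    mul_add, mul_add, Finset.mul_sum]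
  have h3 : ∑ i ∈ S, (y a - y b) * (c i * (Ring.inverse (y i - y a) *
        ∏ j ∈ (insert b S).erase i, Ring.inverse (y i - y j))) =
      ∑ i ∈ S, c i * (Ring.inverse (y i - y a) * ∏ j ∈ S.erase i, Ring.inverse (y i - y j)) -
      ∑ i ∈ S, c i * (Ring.inverse (y i - y b) * ∏ j ∈ S.erase i, Ring.inverse (y i - y j)) := by
    rw [← Finset.sum_sub_distrib]
    refine Finset.sum_congr rfl fun i hi => ?_
    have hia : i ≠ a := fun h => ha (h ▸ hi)
    have hib : i ≠ b := fun h => hb (h ▸ hi)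
    rw [Finset.erase_insert_of_ne hib.symm,
      Finset.prod_insert fun h => hb (Finset.mem_of_mem_erase h)]
    have e1 := Ring.mul_inverse_cancel _ (hy i a hia)
    have e2 := Ring.mul_inverse_cancel _ (hy i b hib)
    linear_combination (c i * ∏ j ∈ S.erase i, Ring.inverse (y i - y j)) *
      (Ring.inverse (y i - y a) * e2 - Ring.inverse (y i - y b) * e1)
  rw [h3]
  linear_combination (c a * ∏ j ∈ S, Ring.inverse (y a - y j)) * h1 -
    (c b * ∏ j ∈ S, Ring.inverse (y b - y j)) * h2

/-- A function of finite sets with the recursion of the divided differences and the values `c_i` on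
singletons is the divided difference. -/
theorem eq_divDiff {y : ι → K} (hy : ∀ i j, i ≠ j → IsUnit (y i - y j)) {c : ι → K}
    {r : Finset ι → K} (hr₁ : ∀ i, r {i} = c i)
    (hr : ∀ S a b, a ∉ S → b ∉ S → a ≠ b →
      (y a - y b) * r (insert a (insert b S)) = r (insert a S) - r (insert b S))
    {S : Finset ι} (hS : S.Nonempty) : r S = divDiff y c S := by
  obtain ⟨m, hm⟩ : ∃ m, S.card = m + 1 := ⟨S.card - 1, by have := hS.card_pos; omega⟩
  induction m generalizing S with
  | zero =>
    obtain ⟨i, rfl⟩ := Finset.card_eq_one.1 hm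
    simp [hr₁, divDiff]
  | succ m ih =>
    obtain ⟨a, T, haT, rfl, hT⟩ := Finset.card_eq_succ.1 hm
    obtain ⟨b, U, hbU, rfl, hU⟩ := Finset.card_eq_succ.1 hT
    have hab : a ≠ b := fun h => haT (by simp [h])
    have haU : a ∉ U := fun h => haT (by simp [h])
    rw [← (hy a b hab).mul_right_inj, hr U a b haU hbU hab,
      sub_mul_divDiff_insert_insert hy c haU hbU hab,
      ih (Finset.insert_nonempty _ _) (by rw [Finset.card_insert_of_notMem haU, hU]),
      ih (Finset.insert_nonempty _ _) hT]

end DividedDifference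

/-! ### The residue formula for a formal group law -/

section ResidueFormula

variable {σ R : Type*} [CommRing R] (F : FormalGroup R)

theorem isUnit_algebraMap_fsum_finv {K : Type*} [CommRing K] [Algebra (MvPowerSeries σ R) K]
    {i j : σ} (hK : IsUnit (algebraMap (MvPowerSeries σ R) K (X i - X j))) :
    IsUnit (algebraMap (MvPowerSeries σ R) K (fsum F (X i) (finv F (X j)))) := by
  rw [fsum_finv_eq F (constantCoeff_X _) (constantCoeff_X _), map_mul]
  exact hK.mul ((isUnit_subst_diffQuot F (constantCoeff_X _) (constantCoeff_X _)).map _)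

variable [Fintype σ]

variable (σ) in
/-- `p(t) ∏_i (t +_F [-1]_F(x_i))` in `R((t))[[x]]`, where `p(t) = 1 + ∑_{i ≥ 1} a_{i,1} t^i`.
For the universal formal group law this is `residueDenom` by definition. -/
def laurentDenom : MvPowerSeries σ (LaurentSeries R) :=
  C (HahnSeries.ofPowerSeries ℤ R (partialSnd F)) *
    ∏ i : σ, laurentIncl (fsum F (X none) (finv F (X (some i))))

variable (σ) in
/-- The quotient `p(t) ∏_i G(t, x_i)` of `p(t) ∏_i (t +_F [-1]_F(x_i))` by `∏_i (t - x_i)`. -/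
def denomUnit : MvPowerSeries (Option σ) R :=
  rename (fun _ : Unit => none) (partialSnd F) *
    ∏ i : σ, (diffQuot F).subst ![X none, (X (some i) : MvPowerSeries (Option σ) R)]

theorem laurentDenom_eq :
    laurentDenom σ F = laurentIncl (denomUnit σ F) * ∏ i : σ, tSub R i := by
  have h (i : σ) : laurentIncl (fsum F (X none) (finv F (X (some i)))) = tSub R i *
      laurentIncl ((diffQuot F).subst ![X none, (X (some i) : MvPowerSeries (Option σ) R)]) := by
    rw [fsum_finv_eq F (constantCoeff_X _) (constantCoeff_X _), map_mul, tSub]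
  rw [laurentDenom, denomUnit, C_ofPowerSeries_eq, map_mul, map_prod,
    Finset.prod_congr rfl fun i _ => h i, Finset.prod_mul_distrib]
  ring

theorem isUnit_denomUnit : IsUnit (denomUnit σ F) := by
  refine IsUnit.mul ?_ (IsUnit.prod_univ_iff.2 fun i =>
    isUnit_subst_diffQuot F (constantCoeff_X _) (constantCoeff_X _))
  rw [isUnit_iff_constantCoeff, constantCoeff_rename]
  have h : PowerSeries.coeff 0 (partialSnd F) = 1 := by
    rw [coeff_partialSnd, Finsupp.single_zero, zero_add, F.lin_coeff_Y]
  rw [PowerSeries.coeff_zero_eq_constantCoeff_apply] at h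
  exact h.symm ▸ isUnit_one

theorem isUnit_laurentDenom : IsUnit (laurentDenom σ F) := by
  rw [laurentDenom_eq]
  exact ((isUnit_denomUnit F).map laurentIncl).mul (IsUnit.prod_univ_iff.2 fun i => isUnit_tSub i)

theorem laurentCoeff_neg_one_pow_mul_inverse (m : ℕ) :
    laurentCoeff (-1) (laurentMonomial σ R m * Ring.inverse (laurentDenom σ F)) =
      residue (X none ^ m * Ring.inverse (denomUnit σ F)) Finset.univ := by
  have h : Ring.inverse (laurentIncl (denomUnit σ F)) =
      laurentIncl (Ring.inverse (denomUnit σ F)) := by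
    rw [← ((isUnit_denomUnit F).map laurentIncl).mul_right_inj,
      Ring.mul_inverse_cancel _ ((isUnit_denomUnit F).map laurentIncl), ← map_mul,
      Ring.mul_inverse_cancel _ (isUnit_denomUnit F), map_one]
  have h' : Ring.inverse (∏ i : σ, tSub R i) = ∏ i : σ, Ring.inverse (tSub R i) :=
    map_prod MonoidWithZero.inverse _ _
  rw [residue, map_mul, laurentDenom_eq, Ring.mul_inverse_rev, h, h', laurentMonomial_natCast]
  congr 1
  ring

/-- The factor `p(x_i)` cancels against `G(x_i, x_i)`. -/
theorem evalT_denomUnit [F.IsComm] [DecidableEq σ] (i : σ) :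
    evalT i (denomUnit σ F) =
      ∏ j ∈ Finset.univ.erase i, (diffQuot F).subst ![X i, (X j : MvPowerSeries σ R)] := by
  have h₁ (j : σ) : evalT i
      ((diffQuot F).subst ![X none, (X (some j) : MvPowerSeries (Option σ) R)]) =
      (diffQuot F).subst ![X i, (X j : MvPowerSeries σ R)] := by
    rw [evalT, rename_eq_subst, subst_comp_subst_apply
      (hasSubst_cons (constantCoeff_X _) (constantCoeff_X _)) (HasSubst.X_comp _)]
    congr 1
    funext s
    fin_cases s <;> simp [subst_X (HasSubst.X_comp _)]
  have h₂ : rename (fun _ : Unit => i) (partialSnd F) *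
      (diffQuot F).subst ![X i, (X i : MvPowerSeries σ R)] = 1 := by
    have h := congrArg (rename (fun _ : Unit => i)) (partialSnd_mul_diffQuot F)
    rw [map_mul, map_one] at h
    rw [← h]
    congr 1
    rw [rename_eq_subst, subst_comp_subst_apply
      (hasSubst_pair PowerSeries.constantCoeff_X) (HasSubst.X_comp _)]
    congr 1
    funext s
    fin_cases s <;> simp [PowerSeries.X, subst_X (HasSubst.X_comp _)]
  have h₃ : evalT i (rename (fun _ : Unit => none) (partialSnd F)) =
      rename (fun _ : Unit => i) (partialSnd F) := by
    rw [evalT, rename_rename]; rfl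
  rw [denomUnit, map_mul, map_prod, h₃, Finset.prod_congr rfl fun j _ => h₁ j,
    ← Finset.mul_prod_erase _ _ (Finset.mem_univ i), ← mul_assoc, h₂, one_mul]

/-- The residue of `t^m dt / (p(t) ∏_i (t +_F [-1]_F(x_i)))` is
`∑_i x_i^m / ∏_{j ≠ i} (x_i +_F [-1]_F(x_j))`, in any ring in which the `x_i - x_j` are
invertible. -/
theorem algebraMap_residue_eq_sum [F.IsComm] [DecidableEq σ] [Nonempty σ] {K : Type*} [CommRing K]
    [Algebra (MvPowerSeries σ R) K]
    (hK : ∀ i j : σ, i ≠ j → IsUnit (algebraMap (MvPowerSeries σ R) K (X i - X j))) (m : ℕ) :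
    algebraMap (MvPowerSeries σ R) K
        (laurentCoeff (-1) (laurentMonomial σ R m * Ring.inverse (laurentDenom σ F))) =
      ∑ i : σ, algebraMap (MvPowerSeries σ R) K (X i ^ m) *
        Ring.inverse (algebraMap (MvPowerSeries σ R) K
          (∏ j ∈ Finset.univ.erase i, fsum F (X i) (finv F (X j)))) := by
  let φ := algebraMap (MvPowerSeries σ R) K
  set f : MvPowerSeries (Option σ) R := X none ^ m * Ring.inverse (denomUnit σ F) with hf
  have hres : φ (residue f Finset.univ) =
      divDiff (fun i : σ => φ (X i)) (fun i => φ (evalT i f)) Finset.univ := by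
    refine eq_divDiff (r := fun S => φ (residue f S)) (fun i j hij => ?_) (fun i => ?_)
      (fun S a b ha hb hab => ?_) Finset.univ_nonempty
    · rw [← map_sub]; exact hK i j hij
    · rw [residue_singleton]
    · rw [← map_sub, ← map_mul, sub_mul_residue_insert_insert f ha hb hab, map_sub]
  rw [laurentCoeff_neg_one_pow_mul_inverse, ← hf]
  refine hres.trans (Finset.sum_congr rfl fun i _ => ?_)
  have hprod : ∏ j ∈ Finset.univ.erase i, fsum F (X i) (finv F (X j)) =
      (∏ j ∈ Finset.univ.erase i, (X i - X j)) * evalT i (denomUnit σ F) := by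
    rw [evalT_denomUnit, ← Finset.prod_mul_distrib]
    exact Finset.prod_congr rfl fun j _ => fsum_finv_eq F (constantCoeff_X _) (constantCoeff_X _)
  have hinv : Ring.inverse (∏ j ∈ Finset.univ.erase i, (φ (X i) - φ (X j))) =
      ∏ j ∈ Finset.univ.erase i, Ring.inverse (φ (X i) - φ (X j)) :=
    map_prod MonoidWithZero.inverse _ _
  have hu : IsUnit (φ (evalT i (denomUnit σ F))) := ((isUnit_denomUnit F).map _).map _
  have hev : φ (evalT i f) = φ (X i ^ m) * Ring.inverse (φ (evalT i (denomUnit σ F))) := by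
    rw [← hu.mul_left_inj, Ring.inverse_mul_cancel_right _ _ hu, ← map_mul, ← map_mul, hf,
      Ring.inverse_mul_cancel_right _ _ (isUnit_denomUnit F), evalT, map_pow, rename_X]
    rfl
  rw [hprod, map_mul, map_prod, Ring.mul_inverse_rev]
  simp only [map_sub]
  rw [← hinv, hev]
  ring

end ResidueFormula

/-! ### Schur functions of one-row partitions -/

section OneRow

variable {n : ℕ}

theorem oneRow_lt_oneRow {k : ℕ} (hk : 1 ≤ k) (i j : Fin n) :
    oneRow n k j < oneRow n k i ↔ i.val = 0 ∧ j.val ≠ 0 := by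
  simp only [oneRow]
  split_ifs <;> omega

theorem filter_oneRow (hn : 0 < n) {k : ℕ} (hk : 1 ≤ k) :
    (Finset.univ.filter fun p : Fin n × Fin n => oneRow n k p.2 < oneRow n k p.1) =
      (Finset.univ.erase (⟨0, hn⟩ : Fin n)).map
        ⟨fun j => (⟨0, hn⟩, j), Prod.mk_right_injective _⟩ := by
  ext ⟨a, b⟩
  rw [Finset.mem_filter, oneRow_lt_oneRow hk]
  simp only [Finset.mem_univ, true_and, Finset.mem_map, Finset.mem_erase, and_true,
    Function.Embedding.coeFn_mk, Prod.mk.injEq]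
  constructor
  · rintro ⟨ha, hb⟩
    exact ⟨b, fun h => hb (congrArg Fin.val h), Fin.ext ha.symm, rfl⟩
  · rintro ⟨c, hc, rfl, rfl⟩
    exact ⟨rfl, fun h => hc (Fin.ext h)⟩

theorem schurTerm_oneRow (hn : 0 < n) {k : ℕ} (hk : 1 ≤ k) (w : Equiv.Perm (Fin n)) :
    schurTerm (oneRow n k) w =
      algebraMap (XSeries n) (XFrac n) (X (w ⟨0, hn⟩) ^ (k + n - 1)) *
        Ring.inverse (algebraMap (XSeries n) (XFrac n)
          (∏ j ∈ Finset.univ.erase (w ⟨0, hn⟩), xDiff (w ⟨0, hn⟩) j)) := by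
  have h₁ : (∏ i, (X (w i) : XSeries n) ^
      (oneRow n k i + (Finset.univ.filter fun j => oneRow n k j < oneRow n k i).card)) =
      X (w ⟨0, hn⟩) ^ (k + n - 1) := by
    rw [Finset.prod_eq_single ⟨0, hn⟩]
    · have : (Finset.univ.filter fun j => oneRow n k j < oneRow n k ⟨0, hn⟩) =
          Finset.univ.erase ⟨0, hn⟩ := by
        ext j
        rw [Finset.mem_filter, oneRow_lt_oneRow hk]
        simp [Fin.ext_iff]
      rw [this, Finset.card_erase_of_mem (Finset.mem_univ _), Finset.card_univ, Fintype.card_fin]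
      congr 1
      simp only [oneRow, if_true]
      omega
    · intro i _ hi
      have hi0 : i.val ≠ 0 := fun h => hi (Fin.ext h)
      have : oneRow n k i = 0 := if_neg hi0
      simp [this]
    · simp
  have h₂ : (∏ p : Fin n × Fin n with oneRow n k p.2 < oneRow n k p.1,
        xDiff (w p.1) (w p.2)) =
      ∏ j ∈ Finset.univ.erase (w ⟨0, hn⟩), xDiff (w ⟨0, hn⟩) j := by
    rw [filter_oneRow hn hk, Finset.prod_map]
    exact Finset.prod_equiv w (fun j => by simp) (fun j _ => rfl)
  rw [schurTerm, h₁, h₂]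

theorem mem_stab_oneRow (hn : 0 < n) {k : ℕ} (hk : 1 ≤ k) (s : Equiv.Perm (Fin n)) :
    s ∈ stab (oneRow n k) ↔ s ⟨0, hn⟩ = ⟨0, hn⟩ := by
  change (∀ i, oneRow n k (s i) = oneRow n k i) ↔ _
  constructor
  · intro h
    have := h ⟨0, hn⟩
    simp only [oneRow, if_true] at this
    rw [Fin.ext_iff]
    by_contra h0
    rw [if_neg h0] at this
    omega
  · intro h i
    have : (s i).val = 0 ↔ i.val = 0 := by
      rw [← Fin.ext_iff (b := (⟨0, hn⟩ : Fin n)), ← Fin.ext_iff (b := (⟨0, hn⟩ : Fin n))]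
      nth_rewrite 1 [← h]
      exact s.injective.eq_iff
    simp only [oneRow, this]

/-- The cosets of the stabilizer of `(k, 0, …, 0)` correspond to the images of the first index. -/
theorem exists_coset_equiv_fin (hn : 0 < n) {k : ℕ} (hk : 1 ≤ k) :
    ∃ e : (Equiv.Perm (Fin n) ⧸ stab (oneRow n k)) ≃ Fin n,
      ∀ w : Equiv.Perm (Fin n), e (QuotientGroup.mk w) = w ⟨0, hn⟩ := by
  have key (w w' : Equiv.Perm (Fin n)) :
      w⁻¹ * w' ∈ stab (oneRow n k) ↔ w ⟨0, hn⟩ = w' ⟨0, hn⟩ := by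
    rw [mem_stab_oneRow hn hk, Equiv.Perm.mul_apply, Equiv.Perm.inv_eq_iff_eq, eq_comm]
  refine ⟨Equiv.ofBijective (fun c => Quotient.liftOn' c (fun w => w ⟨0, hn⟩)
    fun w w' h => (key w w').1 (QuotientGroup.leftRel_apply.1 h)) ⟨?_, ?_⟩, fun w => rfl⟩
  · rintro ⟨w⟩ ⟨w'⟩ h
    exact QuotientGroup.eq.2 ((key w w').2 h)
  · intro i
    exact ⟨QuotientGroup.mk (Equiv.swap ⟨0, hn⟩ i), Equiv.swap_apply_left _ _⟩

theorem newSchur_oneRow (hn : 0 < n) {k : ℕ} (hk : 1 ≤ k) :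
    newSchur (oneRow n k) = rowSum n k := by
  obtain ⟨e, he⟩ := exists_coset_equiv_fin hn hk
  have hk' : ((k : ℤ) + n - 1).toNat = k + n - 1 := by omega
  rw [newSchur, rowSum, ← finsum_eq_sum_of_fintype, hk']
  rw [← finsum_comp_equiv e]
  refine finsum_congr fun c => ?_
  obtain ⟨w, rfl⟩ := QuotientGroup.mk_surjective c
  rw [he]
  exact schurTerm_oneRow hn hk w

end OneRow

/-! ### Specialization to the Lazard ring -/

section Lazard

variable {n : ℕ}

theorem isUnit_algebraMap_X_sub_X {i j : Fin n} (hij : i ≠ j) :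
    IsUnit (algebraMap (XSeries n) (XFrac n) (X i - X j)) :=
  IsLocalization.map_units (XFrac n)
    (⟨X i - X j, X_sub_X_mem_nonZeroDivisors hij⟩ : nonZeroDivisors (XSeries n))

/-- The residue in the definition of `S^𝕃_k` for `k < 1 - n` is, for every `k`, the coefficient of
`t^(-k)` in the generating series, as the two series differ by the factor `t^(k - 1)`. -/
theorem rowResidue_eq (k : ℤ) :
    rowResidue n k = tCoeff (-k) (tPow n n * Ring.inverse (residueDenom n)) := by
  refine (laurentCoeff_laurentMonomial_mul (-1) (k + n - 1) _).trans
    (Eq.trans ?_ (laurentCoeff_laurentMonomial_mul (-k) n _).symm)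
  congr 1
  ring

/-- For `k ≥ 1 - n` the residue defining `rowResidue` is the sum defining `rowSum`; for `k < 1 - n`
the factor `t^(k + n - 1)` is not a power series in `t`, and the residue formula does not apply. -/
theorem rowSum_eq (hn : 1 ≤ n) {k : ℤ} (hk : 1 - (n : ℤ) ≤ k) :
    rowSum n k = algebraMap (XSeries n) (XFrac n) (rowResidue n k) := by
  have : Nonempty (Fin n) := ⟨⟨0, hn⟩⟩
  have h := algebraMap_residue_eq_sum (K := XFrac n) lazardLaw
    (fun i j hij => isUnit_algebraMap_X_sub_X hij) (k + n - 1).toNat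
  rw [Int.toNat_of_nonneg (by omega)] at h
  exact h.symm

end Lazard

end UniversalSchur

end

/-- In the last clause `u = t⁻¹`: the element `u^(-n) / ((1 + ∑_{i ≥ 1} a_{i,1} u^(-i)) ∏_i
(u⁻¹ +_𝕃 x̄_i))` of `𝕃((t))[[x_1, …, x_n]]` has `S^𝕃_k(x_1, …, x_n)` as its coefficient of
`u^k = t^(-k)`, for every integer `k`. The first two clauses say that all divisions make sense. -/
theorem mainTheorem11 (n : ℕ) (hn : 1 ≤ n) :
    (∀ i j : Fin n, i ≠ j → IsUnit (algebraMap (XSeries n) (XFrac n) (xDiff i j))) ∧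
    IsUnit (residueDenom n) ∧
    ∀ k : ℤ, rowSchur n k = algebraMap (XSeries n) (XFrac n)
      (tCoeff (-k) (tPow n n * Ring.inverse (residueDenom n))) := by
  refine ⟨fun i j hij => isUnit_algebraMap_fsum_finv lazardLaw (isUnit_algebraMap_X_sub_X hij),
    isUnit_laurentDenom lazardLaw, fun k => ?_⟩
  rw [← rowResidue_eq, rowSchur]
  split_ifs with h₁ h₂
  · have hk : ((k.toNat : ℕ) : ℤ) = k := Int.toNat_of_nonneg (by omega)
    rw [newSchur_oneRow hn (by omega), hk, rowSum_eq hn (by omega)]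
  · exact rowSum_eq hn h₂
  · rfl
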